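/- Notation. Let $\mathbb{D}$ be the open unit disc, $\mathbb{T}$ the unit circle, $\mathbb{T}^2$ the torus with Haar probability measure $m$; $|\cdot|$ denotes $m$ on $\mathbb{T}^2$ and normalized arc length on $\mathbb{T}$. For $w=(w_1,w_2)\in\mathbb{D}^2$ let $S_w(z)=\prod_{i=1}^2(1-\overline{w_i}z_i)^{-1}$ be the Szegő kernel, and let $\|\cdot\|_2$, $\langle\cdot,\cdot\rangle$ be the norm and inner product of the Hardy space $H^2(\mathbb{D}^2)$, i.e. $\|f\|_2^2=\sup_{0<r<1}\int_{\mathbb{T}^2}|f(r\zeta)|^2\,dm(\zeta)$ and $\langle f,g\rangle=\lim_{r\to1^-}\int_{\mathbb{T}^2}f(r\zeta)\overline{g(r\zeta)}\,dm(\zeta)$; put $g_w=S_w/\|S_w\|_2$. Let $\sigma(z_1,z_2)=(\overline{z_1},z_2)$. For an arc $I\subseteq\mathbb{T}$ let $S(I)=\{z\in\mathbb{D}\setminus\{0\}: 1-|z|\le|I|,\ z/|z|\in I\}$, and for an open set $V\subseteq\mathbb{T}^2$ let $S(V)$ be the union of all $S(I)\times S(J)$ over arcs $I,J$ with $I\times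 J\subseteq V$. For a finite set $\Lambda\subset\mathbb{D}^2$ let $\mu_\Lambda=\sum_{\lambda\in\Lambda}(1-|\lambda_1|^2)(1-|\lambda_2|^2)\,\delta_\lambda$. A supremum over an empty set of non-negative numbers is $0$. Statement. There exist constants $0<\gamma<1$ and $\Delta>0$ such that for every $\varepsilon>0$ there is a finite set $\Lambda\subset\mathbb{D}^2$ with $\sigma(\Lambda)=\Lambda$ such that (a) $\Lambda$ is $\gamma$-weakly separated: $\sqrt{1-\sup_{\lambda\ne\lambda'\in\Lambda}|\langle g_\lambda,g_{\lambda'}\rangle|^2}\ \ge\ \gamma$; (b) $\Lambda$ is $\Delta$-column bounded: $\sup_{\lambda'\in\Lambda}\sum_{\lambda\in\Lambda,\,\lambda\ne\lambda'}|\langle g_\lambda,g_{\lambda'}\rangle|^2\le\Delta$; (c) $\displaystyle\sup_{\emptyset\ne V\subseteq\mathbb{T}^2\text{ open}}\frac{\mu_\Lambda(S(V))}{|V|}\ \ge\ \varepsilon^{-1}$; (d) $\|S_\lambda\|_2$ is the same for all $\lambda\in\Lambda$. -/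

import Mathlib

open scoped ComplexConjugate ENNReal

namespace Bidisc

noncomputable section

/-- The open bidisc `𝔻²` in `ℂ²`. -/
def bidisc : Set (ℂ × ℂ) := Metric.ball 0 1 ×ˢ Metric.ball 0 1

/-- The circle `𝕋`, identified with `ℝ/ℤ`; its `volume` is the Haar probability measure, so that
`volume I` is the normalized length `|I|`. The point with coordinate `θ` is `e^{2πiθ}`. -/
abbrev Circ : Type := UnitAddCircle

/-- The torus `𝕋²`; its `volume` is the product measure, i.e. the Haar probability measure `m`. -/
abbrev Torus : Type := Circ × Circ

/-- The point `r ζ` of `ℂ²`, for `ζ ∈ 𝕋²` with coordinates `θ`. -/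
def dilate (r : ℝ) (θ : Torus) : ℂ × ℂ :=
  ((r : ℂ) * (AddCircle.toCircle θ.1 : ℂ), (r : ℂ) * (AddCircle.toCircle θ.2 : ℂ))

/-- The reflection `σ(z₁, z₂) = (conj z₁, z₂)`. -/
def sigma (z : ℂ × ℂ) : ℂ × ℂ := (conj z.1, z.2)

/-! ### The Hardy space `H²(𝔻²)` and the Szegő kernel -/

/-- The norm of `H²(𝔻²)`: `‖f‖₂² = sup_{0<r<1} ∫_{𝕋²} |f(rζ)|² dm(ζ)`. -/
def hardyNorm (f : ℂ × ℂ → ℂ) : ℝ :=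
  √(⨆ r ∈ Set.Ioo (0 : ℝ) 1, ∫⁻ θ : Torus, ‖f (dilate r θ)‖ₑ ^ 2).toReal

/-- The inner product of `H²(𝔻²)`: `⟨f, g⟩ = lim_{r → 1⁻} ∫_{𝕋²} f(rζ) conj(g(rζ)) dm(ζ)`
(the limit exists for all `f, g ∈ H²(𝔻²)`). -/
def hardyInner (f g : ℂ × ℂ → ℂ) : ℂ :=
  Filter.limUnder (nhdsWithin (1 : ℝ) (Set.Iio 1))
    (fun r : ℝ => ∫ θ : Torus, f (dilate r θ) * conj (g (dilate r θ)))

/-- The Szegő kernel `S_w(z) = ∏ᵢ 1 / (1 - conj(wᵢ) zᵢ)`. -/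
def szego (w z : ℂ × ℂ) : ℂ :=
  (1 / (1 - conj w.1 * z.1)) * (1 / (1 - conj w.2 * z.2))

/-- The normalized Szegő kernel `g_w = S_w / ‖S_w‖₂`. -/
def normSzego (w z : ℂ × ℂ) : ℂ := szego w z / (hardyNorm (szego w) : ℂ)

/-! ### Weak separation and column boundedness of a finite set of points -/

/-- The constant of weak separation `√(1 - sup_{a ≠ b} |⟨g_a, g_b⟩|²)`
(with supremum `0` if there are no two different points). -/
def weakSepConst (Λ : Finset (ℂ × ℂ)) : ℝ :=
  √(1 - sSup {x : ℝ | ∃ a ∈ Λ, ∃ b ∈ Λ, a ≠ b ∧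
    x = ‖hardyInner (normSzego a) (normSzego b)‖ ^ 2})

/-- `Λ` is `γ`-weakly separated: its constant of weak separation is at least `γ`. -/
def WeaklySeparated (γ : ℝ) (Λ : Finset (ℂ × ℂ)) : Prop := γ ≤ weakSepConst Λ

/-- The column boundedness constant `sup_b ∑_{a ≠ b} |⟨g_a, g_b⟩|²`. -/
def columnConst (Λ : Finset (ℂ × ℂ)) : ℝ :=
  sSup {x : ℝ | ∃ b ∈ Λ, x = ∑ a ∈ Λ.erase b, ‖hardyInner (normSzego a) (normSzego b)‖ ^ 2}

/-- `Λ` is `Δ`-column bounded: its column boundedness constant is at most `Δ`. -/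
def ColumnBounded (Δ : ℝ) (Λ : Finset (ℂ × ℂ)) : Prop := columnConst Λ ≤ Δ

/-! ### Carleson regions and the measure of a finite set of points -/

/-- An arc of the circle: a nonempty connected subset. -/
def IsArc (I : Set Circ) : Prop := IsConnected I

/-- The Carleson region `S(I) = {z ∈ 𝔻 \ {0} : 1 - |z| ≤ |I|, z/|z| ∈ I}`. -/
def region (I : Set Circ) : Set ℂ :=
  {z | z ∈ Metric.ball (0 : ℂ) 1 ∧ z ≠ 0 ∧ 1 - ‖z‖ ≤ (MeasureTheory.volume I).toReal ∧
    ∃ θ ∈ I, z / (‖z‖ : ℂ) = (AddCircle.toCircle θ : ℂ)}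

/-- `S(V)`: the union of the boxes `S(I) × S(J)` over all rectangles `I × J ⊆ V`. -/
def tent (V : Set Torus) : Set (ℂ × ℂ) :=
  {z | ∃ I J : Set Circ, IsArc I ∧ IsArc J ∧ I ×ˢ J ⊆ V ∧ z ∈ region I ×ˢ region J}

/-- The measure `μ_Λ = ∑_{λ ∈ Λ} (1 - |λ₁|²)(1 - |λ₂|²) δ_λ`. -/
def pointMeasure (Λ : Finset (ℂ × ℂ)) : MeasureTheory.Measure (ℂ × ℂ) :=
  ∑ a ∈ Λ, ENNReal.ofReal ((1 - ‖a.1‖ ^ 2) * (1 - ‖a.2‖ ^ 2)) • MeasureTheory.Measure.dirac a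

end

end Bidisc

namespace Bidisc

open MeasureTheory Filter Topology

/-! ### Integrals over the circle and the torus -/

/-! The bidisc contains arbitrarily many incompatible grids at the same scale of area. For each `a,
b ≥ 1` with `a + b = n + 1`, take the product of `2ᵃ` equally spaced points at height `1 - r² = 2⁻ᵃ`
with `2ᵇ` such points at height `2⁻ᵇ`. Such a grid has `2ⁿ⁺¹` points, each of weight `2⁻⁽ⁿ⁺¹⁾`,
hence total mass one. The `n` grids are disjoint, so their union has mass `n`, and all of it lies
over the whole torus, of measure one. Thus `V = 𝕋²` already gives (c). The common weight gives (d),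
and conjugation preserves the roots of unity.

The separation constants stay bounded because the squared inner product factors into two
one-variable terms (`norm_hardyInner_normSzego_sq`). Two distinct points either have first heights
differing by a factor of at least 2, or lie in one grid and differ in angle in some coordinate. In
both cases one factor is at most `8/9`, giving `γ = 1/3`.

For the column sums, `sum_kernelSq_ringPoints_le` sums a Poisson kernel exactly over a ring. The sum
is bounded, and it decays geometrically when the fixed point is closer to the boundary than the
ring. Between grids `i` and `j` one coordinate becomes finer as the other becomes coarser, so one of
the two ring sums always decays. The contribution is at most `49 · 2^(-|i-j|)`, which is summable in
`i` uniformly in `n`. -/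

instance : IsProbabilityMeasure (volume : Measure Circ) := ⟨UnitAddCircle.measure_univ⟩

/-- Rotation by half a period of the character changes its sign but not its integral. -/
lemma integral_toCircle_pow {n : ℕ} (hn : n ≠ 0) :
    ∫ θ : Circ, (AddCircle.toCircle θ : ℂ) ^ n = 0 := by
  have key : ∀ θ : Circ, (AddCircle.toCircle θ : ℂ) ^ n = fourier (n : ℤ) θ := by
    intro θ
    rw [fourier_apply, natCast_zsmul, AddCircle.toCircle_nsmul]
    simp
  simp_rw [key]
  have h := integral_add_right_eq_self (μ := (volume : Measure Circ))
    (fun θ : Circ => (fourier (n : ℤ) θ : ℂ)) (((1 : ℝ) / 2 / (n : ℤ) : ℝ) : Circ)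
  have h2 := fun θ : Circ => fourier_add_half_inv_index (T := (1 : ℝ)) (n := (n : ℤ))
    (by exact_mod_cast hn) one_pos θ
  simp only [h2, integral_neg] at h
  exact self_eq_neg.mp h.symm

lemma one_sub_ne_zero_of_norm_lt {z : ℂ} (hz : ‖z‖ < 1) : 1 - z ≠ 0 := by
  intro h
  rw [← sub_eq_zero.mp h] at hz
  simp at hz

lemma norm_mul_toCircle (p : ℂ) (θ : Circ) : ‖p * (AddCircle.toCircle θ : ℂ)‖ = ‖p‖ := by
  rw [norm_mul, Circle.norm_coe, mul_one]

lemma continuous_inv_one_sub {p : ℂ} (hp : ‖p‖ < 1) :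
    Continuous fun θ : Circ => 1 / (1 - p * (AddCircle.toCircle θ : ℂ)) := by
  have hc : Continuous fun θ : Circ => (AddCircle.toCircle θ : ℂ) :=
    continuous_subtype_val.comp AddCircle.continuous_toCircle
  refine continuous_const.div (continuous_const.sub (continuous_const.mul hc)) fun θ => ?_
  exact one_sub_ne_zero_of_norm_lt (by rwa [norm_mul_toCircle])

lemma integrable_of_continuous_circ {f : Circ → ℂ} (hf : Continuous f) : Integrable f :=
  hf.integrable_of_hasCompactSupport (HasCompactSupport.of_compactSpace f)

/-- Mean value property: in the geometric series only the constant term has a nonzero integral. -/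
lemma integral_inv_one_sub {p : ℂ} (hp : ‖p‖ < 1) :
    ∫ θ : Circ, 1 / (1 - p * (AddCircle.toCircle θ : ℂ)) = 1 := by
  have hc : Continuous fun θ : Circ => (AddCircle.toCircle θ : ℂ) :=
    continuous_subtype_val.comp AddCircle.continuous_toCircle
  have h := hasSum_integral_of_summable_integral_norm (μ := (volume : Measure Circ))
    (F := fun (n : ℕ) (θ : Circ) => (p * (AddCircle.toCircle θ : ℂ)) ^ n)
    (fun n => integrable_of_continuous_circ ((continuous_const.mul hc).pow n))
    (by
      simp only [norm_pow, norm_mul_toCircle, integral_const, probReal_univ, one_smul]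
      exact summable_geometric_of_lt_one (norm_nonneg _) hp)
  have h1 : ∀ θ : Circ, ∑' n : ℕ, (p * (AddCircle.toCircle θ : ℂ)) ^ n
      = 1 / (1 - p * (AddCircle.toCircle θ : ℂ)) := fun θ => by
    rw [tsum_geometric_of_norm_lt_one (by rwa [norm_mul_toCircle]), one_div]
  simp only [h1] at h
  have h2 : ∀ n : ℕ, n ≠ 0 → ∫ θ : Circ, (p * (AddCircle.toCircle θ : ℂ)) ^ n = 0 := by
    intro n hn
    simp_rw [mul_pow]
    rw [integral_const_mul, integral_toCircle_pow hn, mul_zero]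
  refine h.unique ?_
  have h0 : ∫ θ : Circ, (p * (AddCircle.toCircle θ : ℂ)) ^ 0 = 1 := by simp
  exact h0 ▸ hasSum_single 0 h2

/-- Writing `P` and `Q` for the two factors, `ζ * conj ζ = 1` gives the partial fraction identity
`(1 - p * conj q) P Q = P + (Q - 1)`, so only integrals of single factors remain. -/
lemma integral_inv_one_sub_mul_conj {p q : ℂ} (hp : ‖p‖ < 1) (hq : ‖q‖ < 1) :
    ∫ θ : Circ, 1 / (1 - p * (AddCircle.toCircle θ : ℂ)) *
      conj (1 / (1 - q * (AddCircle.toCircle θ : ℂ))) = 1 / (1 - p * conj q) := by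
  have hpq : 1 - p * conj q ≠ 0 := by
    refine one_sub_ne_zero_of_norm_lt ?_
    rw [norm_mul, RCLike.norm_conj]
    nlinarith [norm_nonneg p, norm_nonneg q]
  have h : ∀ θ : Circ, 1 / (1 - p * (AddCircle.toCircle θ : ℂ)) *
      conj (1 / (1 - q * (AddCircle.toCircle θ : ℂ))) = 1 / (1 - p * conj q) *
        (1 / (1 - p * (AddCircle.toCircle θ : ℂ)) +
          (conj (1 / (1 - q * (AddCircle.toCircle θ : ℂ))) - 1)) := by
    intro θ
    have h1 : 1 - p * (AddCircle.toCircle θ : ℂ) ≠ 0 :=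
      one_sub_ne_zero_of_norm_lt (by rwa [norm_mul_toCircle])
    have h2 : 1 - conj q * conj (AddCircle.toCircle θ : ℂ) ≠ 0 :=
      one_sub_ne_zero_of_norm_lt (by rwa [← map_mul, RCLike.norm_conj, norm_mul_toCircle])
    have h3 : (AddCircle.toCircle θ : ℂ) * conj (AddCircle.toCircle θ : ℂ) = 1 := by
      rw [Complex.mul_conj, Complex.normSq_eq_norm_sq, Circle.norm_coe]; simp
    simp only [map_div₀, map_one, map_sub, map_mul]
    field_simp
    linear_combination (p * conj q) * h3
  have i1 := integrable_of_continuous_circ (continuous_inv_one_sub hp)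
  have i2 := integrable_of_continuous_circ
    (Complex.continuous_conj.comp (continuous_inv_one_sub hq))
  simp only [Function.comp_def] at i2
  have e2 : ∫ θ : Circ, (conj (1 / (1 - q * (AddCircle.toCircle θ : ℂ))) - 1) = 0 := by
    rw [integral_sub i2 (integrable_const _), integral_conj, integral_inv_one_sub hq]
    simp
  have e1 := integral_add i1 (i2.sub (integrable_const 1))
  simp only [Pi.sub_apply] at e1
  rw [integral_congr_ae (Eventually.of_forall h), integral_const_mul, e1, e2,
    integral_inv_one_sub hp, add_zero, mul_one]

lemma integral_szego_mul_conj {a b : ℂ × ℂ} (ha : a ∈ bidisc) (hb : b ∈ bidisc) {r : ℝ}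
    (hr : r ∈ Set.Ioo (0 : ℝ) 1) :
    ∫ θ : Torus, szego a (dilate r θ) * conj (szego b (dilate r θ)) =
      1 / (1 - r ^ 2 * (conj a.1 * b.1)) * (1 / (1 - r ^ 2 * (conj a.2 * b.2))) := by
  have hn : ∀ {z : ℂ}, z ∈ Metric.ball (0 : ℂ) 1 → ‖conj z * (r : ℂ)‖ < 1 := by
    intro z hz
    rw [mem_ball_zero_iff] at hz
    rw [norm_mul, RCLike.norm_conj, Complex.norm_real, Real.norm_of_nonneg hr.1.le]
    nlinarith [norm_nonneg z, hr.1, hr.2]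
  have h := integral_prod_mul (μ := (volume : Measure Circ)) (ν := (volume : Measure Circ))
    (fun θ : Circ => 1 / (1 - conj a.1 * r * (AddCircle.toCircle θ : ℂ)) *
      conj (1 / (1 - conj b.1 * r * (AddCircle.toCircle θ : ℂ))))
    (fun θ : Circ => 1 / (1 - conj a.2 * r * (AddCircle.toCircle θ : ℂ)) *
      conj (1 / (1 - conj b.2 * r * (AddCircle.toCircle θ : ℂ))))
  rw [integral_inv_one_sub_mul_conj (hn ha.1) (hn hb.1),
    integral_inv_one_sub_mul_conj (hn ha.2) (hn hb.2)] at h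
  have e : ∀ z w : ℂ, conj z * r * conj (conj w * (r : ℂ)) = r ^ 2 * (conj z * w) := by
    intro z w
    simp only [map_mul, Complex.conj_conj, Complex.conj_ofReal]
    ring
  rw [e, e, ← Measure.volume_eq_prod] at h
  rw [← h]
  refine integral_congr_ae (Eventually.of_forall fun θ => ?_)
  simp only [szego, dilate, map_mul, ← mul_assoc]
  ring

lemma conj_mul_norm_lt {z w : ℂ} (hz : z ∈ Metric.ball (0 : ℂ) 1) (hw : w ∈ Metric.ball (0 : ℂ) 1) :
    ‖conj z * w‖ < 1 := by
  rw [mem_ball_zero_iff] at hz hw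
  rw [norm_mul, RCLike.norm_conj]
  nlinarith [norm_nonneg z, norm_nonneg w]

lemma tendsto_szego_integral {a b : ℂ × ℂ} (ha : a ∈ bidisc) (hb : b ∈ bidisc) :
    Tendsto (fun r : ℝ => 1 / (1 - (r : ℂ) ^ 2 * (conj a.1 * b.1)) *
      (1 / (1 - (r : ℂ) ^ 2 * (conj a.2 * b.2)))) (𝓝[<] 1)
      (𝓝 (1 / (1 - conj a.1 * b.1) * (1 / (1 - conj a.2 * b.2)))) := by
  have hc : ContinuousAt (fun r : ℝ => 1 / (1 - (r : ℂ) ^ 2 * (conj a.1 * b.1)) *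
      (1 / (1 - (r : ℂ) ^ 2 * (conj a.2 * b.2)))) 1 := by
    have h : ∀ z : ℂ, ‖z‖ < 1 → ContinuousAt (fun r : ℝ => 1 / (1 - (r : ℂ) ^ 2 * z)) 1 := by
      intro z hz
      refine ContinuousAt.div continuousAt_const (by fun_prop) ?_
      simpa using one_sub_ne_zero_of_norm_lt hz
    exact (h _ (conj_mul_norm_lt ha.1 hb.1)).mul (h _ (conj_mul_norm_lt ha.2 hb.2))
  have := hc.tendsto.mono_left (nhdsWithin_le_nhds (s := Set.Iio (1 : ℝ)))
  simpa using this

/-- Up to a constant factor, the reproducing property of the Szegő kernel. -/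
lemma hardyInner_normSzego {a b : ℂ × ℂ} (ha : a ∈ bidisc) (hb : b ∈ bidisc) :
    hardyInner (normSzego a) (normSzego b) =
      1 / (1 - conj a.1 * b.1) * (1 / (1 - conj a.2 * b.2)) /
        (hardyNorm (szego a) * hardyNorm (szego b)) := by
  -- The value of `limUnder` is determined only once convergence is known; for `0 < r < 1` the
  -- integral is an explicit function of `r`, which converges.
  refine Tendsto.limUnder_eq ?_
  refine ((tendsto_szego_integral ha hb).div_const _).congr' ?_
  filter_upwards [Ioo_mem_nhdsLT (zero_lt_one' ℝ)] with r hr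
  rw [← integral_szego_mul_conj ha hb hr, ← integral_div]
  refine integral_congr_ae (Eventually.of_forall fun θ => ?_)
  simp only [normSzego, map_div₀, Complex.conj_ofReal]
  rw [div_mul_div_comm]

lemma lintegral_szego {w : ℂ × ℂ} (hw : w ∈ bidisc) {r : ℝ} (hr : r ∈ Set.Ioo (0 : ℝ) 1) :
    ∫⁻ θ : Torus, ‖szego w (dilate r θ)‖ₑ ^ 2 =
      ENNReal.ofReal (1 / (1 - r ^ 2 * ‖w.1‖ ^ 2) * (1 / (1 - r ^ 2 * ‖w.2‖ ^ 2))) := by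
  have h := integral_szego_mul_conj hw hw hr
  have hne : ∀ {z : ℂ}, z ∈ Metric.ball (0 : ℂ) 1 → ∀ θ : Circ,
      1 - conj z * (r * (AddCircle.toCircle θ : ℂ)) ≠ 0 := by
    intro z hz θ
    refine one_sub_ne_zero_of_norm_lt ?_
    rw [mem_ball_zero_iff] at hz
    rw [← mul_assoc, norm_mul_toCircle, norm_mul, RCLike.norm_conj, Complex.norm_real,
      Real.norm_of_nonneg hr.1.le]
    nlinarith [norm_nonneg z, hr.1, hr.2]
  have hc : Continuous fun θ : Circ => (AddCircle.toCircle θ : ℂ) :=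
    continuous_subtype_val.comp AddCircle.continuous_toCircle
  have hf : ∀ z ∈ Metric.ball (0 : ℂ) 1, Continuous fun θ : Circ =>
      1 / (1 - conj z * (r * (AddCircle.toCircle θ : ℂ))) := fun z hz =>
    continuous_const.div (continuous_const.sub (continuous_const.mul (continuous_const.mul hc)))
      (hne hz)
  have hcont : Continuous fun θ : Torus => szego w (dilate r θ) :=
    ((hf _ hw.1).comp continuous_fst).mul ((hf _ hw.2).comp continuous_snd)
  have hint : Integrable (fun θ : Torus => ‖szego w (dilate r θ)‖ ^ 2) :=
    (hcont.norm.pow 2).integrable_of_hasCompactSupport (HasCompactSupport.of_compactSpace _)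
  have e : ∀ θ : Torus, ‖szego w (dilate r θ)‖ₑ ^ 2 =
      ENNReal.ofReal (‖szego w (dilate r θ)‖ ^ 2) := fun θ => by
    rw [ENNReal.ofReal_pow (norm_nonneg _), ofReal_norm]
  simp_rw [e]
  rw [← ofReal_integral_eq_lintegral_ofReal hint (Eventually.of_forall fun θ => by positivity)]
  congr 1
  simp_rw [Complex.mul_conj, Complex.normSq_eq_norm_sq, Complex.conj_mul'] at h
  rw [integral_complex_ofReal] at h
  exact_mod_cast h

/-- The integral over radius `r` is an explicit function bounded by its value at `r = 1` and
continuous there, so the supremum is that value. -/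
lemma hardyNorm_szego {w : ℂ × ℂ} (hw : w ∈ bidisc) :
    hardyNorm (szego w) = √(1 / ((1 - ‖w.1‖ ^ 2) * (1 - ‖w.2‖ ^ 2))) := by
  obtain ⟨h1, h2⟩ := hw
  have g : ∀ {z : ℂ}, z ∈ Metric.ball (0 : ℂ) 1 → 0 < 1 - ‖z‖ ^ 2 := by
    intro z hz
    rw [mem_ball_zero_iff] at hz
    nlinarith [norm_nonneg z]
  have g1 := g h1
  have g2 := g h2
  set F : ℝ → ℝ := fun r => 1 / (1 - r ^ 2 * ‖w.1‖ ^ 2) * (1 / (1 - r ^ 2 * ‖w.2‖ ^ 2)) with hF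
  have hle : ∀ r ∈ Set.Ioo (0 : ℝ) 1, F r ≤ F 1 := by
    intro r hr
    have hr2 : r ^ 2 ≤ 1 := by nlinarith [hr.1, hr.2]
    have k1 : r ^ 2 * ‖w.1‖ ^ 2 ≤ ‖w.1‖ ^ 2 := mul_le_of_le_one_left (by positivity) hr2
    have k2 : r ^ 2 * ‖w.2‖ ^ 2 ≤ ‖w.2‖ ^ 2 := mul_le_of_le_one_left (by positivity) hr2
    simp only [hF, one_pow, one_mul]
    refine mul_le_mul (one_div_le_one_div_of_le g1 (by linarith))
      (one_div_le_one_div_of_le g2 (by linarith)) (one_div_nonneg.mpr (by linarith))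
      (one_div_nonneg.mpr g1.le)
  have hcont : ContinuousAt F 1 := by
    refine ContinuousAt.mul (ContinuousAt.div continuousAt_const (by fun_prop) ?_)
      (ContinuousAt.div continuousAt_const (by fun_prop) ?_)
    · simpa using g1.ne'
    · simpa using g2.ne'
  have hsup : (⨆ r ∈ Set.Ioo (0 : ℝ) 1, ∫⁻ θ : Torus, ‖szego w (dilate r θ)‖ₑ ^ 2) =
      ENNReal.ofReal (F 1) := by
    apply le_antisymm
    · refine iSup₂_le fun r hr => ?_
      rw [lintegral_szego ⟨h1, h2⟩ hr]
      exact ENNReal.ofReal_le_ofReal (hle r hr)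
    · have ht : Tendsto (fun r => ENNReal.ofReal (F r)) (𝓝[<] 1) (𝓝 (ENNReal.ofReal (F 1))) :=
        (ENNReal.continuous_ofReal.tendsto _).comp
          (hcont.tendsto.mono_left nhdsWithin_le_nhds)
      refine le_of_tendsto ht ?_
      filter_upwards [Ioo_mem_nhdsLT (zero_lt_one' ℝ)] with r hr
      rw [← lintegral_szego ⟨h1, h2⟩ hr]
      exact le_iSup₂ (f := fun (r : ℝ) (_ : r ∈ Set.Ioo (0 : ℝ) 1) =>
        ∫⁻ θ : Torus, ‖szego w (dilate r θ)‖ₑ ^ 2) r hr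
  rw [hardyNorm, hsup, ENNReal.toReal_ofReal (by simp only [hF, one_pow, one_mul]; positivity)]
  simp only [hF, one_pow, one_mul]
  rw [one_div_mul_one_div]

/-- The square of the modulus of the inner product of two normalized Szegő kernels of the disc. -/
noncomputable def kernelSq (a b : ℂ) : ℝ :=
  (1 - ‖a‖ ^ 2) * (1 - ‖b‖ ^ 2) / ‖1 - conj a * b‖ ^ 2

lemma norm_hardyInner_normSzego_sq {a b : ℂ × ℂ} (ha : a ∈ bidisc) (hb : b ∈ bidisc) :
    ‖hardyInner (normSzego a) (normSzego b)‖ ^ 2 = kernelSq a.1 b.1 * kernelSq a.2 b.2 := by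
  have g : ∀ {z : ℂ}, z ∈ Metric.ball (0 : ℂ) 1 → 0 < 1 - ‖z‖ ^ 2 := by
    intro z hz
    rw [mem_ball_zero_iff] at hz
    nlinarith [norm_nonneg z]
  have a1 := g ha.1
  have a2 := g ha.2
  have b1 := g hb.1
  have b2 := g hb.2
  rw [hardyInner_normSzego ha hb, hardyNorm_szego ha, hardyNorm_szego hb]
  simp only [norm_div, norm_mul, Complex.norm_real, norm_one, div_pow, mul_pow,
    Real.norm_of_nonneg (Real.sqrt_nonneg _), one_pow, kernelSq]
  rw [Real.sq_sqrt (by positivity), Real.sq_sqrt (by positivity)]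
  have n1 := norm_ne_zero_iff.mpr (one_sub_ne_zero_of_norm_lt (conj_mul_norm_lt ha.1 hb.1))
  have n2 := norm_ne_zero_iff.mpr (one_sub_ne_zero_of_norm_lt (conj_mul_norm_lt ha.2 hb.2))
  field_simp

/-! ### Sums over roots of unity -/

/-- The `M`-th roots of unity in `ℂ`. -/
noncomputable def unityRoots (M : ℕ) : Finset ℂ := Polynomial.nthRootsFinset M (1 : ℂ)

lemma mem_unityRoots {M : ℕ} (hM : M ≠ 0) {z : ℂ} : z ∈ unityRoots M ↔ z ^ M = 1 :=
  Polynomial.mem_nthRootsFinset (Nat.pos_of_ne_zero hM) 1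

lemma card_unityRoots {M : ℕ} (hM : M ≠ 0) : (unityRoots M).card = M :=
  (Complex.isPrimitiveRoot_exp M hM).card_nthRootsFinset

lemma norm_of_mem_unityRoots {M : ℕ} (hM : M ≠ 0) {z : ℂ} (hz : z ∈ unityRoots M) : ‖z‖ = 1 :=
  Complex.norm_eq_one_of_pow_eq_one ((mem_unityRoots hM).mp hz) hM

/-- Multiplication by a primitive root `ω` permutes the roots and multiplies the sum by `ω ^ k ≠ 1`.
-/
lemma sum_unityRoots_pow {M k : ℕ} (hk : k ≠ 0) (hkM : k < M) :
    ∑ z ∈ unityRoots M, z ^ k = 0 := by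
  have hM : M ≠ 0 := by omega
  have hω := Complex.isPrimitiveRoot_exp M hM
  set ω := Complex.exp (2 * Real.pi * Complex.I / M)
  have h : ∑ z ∈ unityRoots M, z ^ k = ∑ z ∈ unityRoots M, (ω * z) ^ k := by
    symm
    refine Finset.sum_bij (fun z _ => ω * z) (fun z hz => ?_) (fun a _ b _ hab => ?_)
      (fun z hz => ⟨ω⁻¹ * z, ?_, ?_⟩) (fun _ _ => rfl)
    · rw [mem_unityRoots hM] at hz ⊢
      rw [mul_pow, hω.pow_eq_one, hz, one_mul]
    · exact mul_left_cancel₀ (hω.ne_zero hM) hab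
    · rw [mem_unityRoots hM] at hz ⊢
      rw [mul_pow, inv_pow, hω.pow_eq_one, hz, inv_one, one_mul]
    · exact mul_inv_cancel_left₀ (hω.ne_zero hM) z
  simp_rw [mul_pow] at h
  rw [← Finset.mul_sum] at h
  have h1 : ω ^ k ≠ 1 := hω.pow_ne_one_of_pos_of_lt hk hkM
  have h2 : (1 - ω ^ k) * ∑ z ∈ unityRoots M, z ^ k = 0 := by linear_combination h
  exact (mul_eq_zero.mp h2).resolve_left (sub_ne_zero.mpr h1.symm)

/-- Since `(u z)^M = u^M`, each term is a finite geometric sum over the common denominator `1 -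
u^M`; summing over `z` kills all powers but the zeroth. -/
lemma sum_inv_one_sub_unityRoots {M : ℕ} (hM : M ≠ 0) {u : ℂ} (hu : ‖u‖ < 1) :
    ∑ z ∈ unityRoots M, 1 / (1 - u * z) = M / (1 - u ^ M) := by
  have hU : 1 - u ^ M ≠ 0 :=
    one_sub_ne_zero_of_norm_lt (by rw [norm_pow]; exact pow_lt_one₀ (norm_nonneg _) hu hM)
  have h : ∀ z ∈ unityRoots M, 1 / (1 - u * z) =
      (∑ k ∈ Finset.range M, u ^ k * z ^ k) / (1 - u ^ M) := by
    intro z hz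
    have hne : 1 - u * z ≠ 0 := one_sub_ne_zero_of_norm_lt (by
      rwa [norm_mul, norm_of_mem_unityRoots hM hz, mul_one])
    have hg := mul_neg_geom_sum (u * z) M
    rw [mul_pow, (mem_unityRoots hM).mp hz, mul_one] at hg
    simp_rw [mul_pow] at hg
    rw [div_eq_div_iff hne hU, one_mul, ← hg]
    ring
  rw [Finset.sum_congr rfl h, ← Finset.sum_div, Finset.sum_comm]
  congr 1
  simp_rw [← Finset.mul_sum]
  rw [Finset.sum_eq_single_of_mem 0 (Finset.mem_range.mpr (Nat.pos_of_ne_zero hM))]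
  · simp [card_unityRoots hM]
  · intro k hk hk0
    rw [sum_unityRoots_pow hk0 (Finset.mem_range.mp hk), mul_zero]

/-- The Poisson kernel as the real part of a Cauchy kernel. -/
lemma poisson_eq_re {v : ℂ} (hv : ‖v‖ < 1) :
    (1 - ‖v‖ ^ 2) / ‖1 - v‖ ^ 2 = (2 * (1 / (1 - v)) - 1).re := by
  have hne := one_sub_ne_zero_of_norm_lt hv
  have h0 : Complex.normSq (1 - v) ≠ 0 := by simpa [Complex.normSq_eq_zero] using hne
  have e : ((2 * (1 / (1 - v)) - 1) : ℂ).re = 2 * ((1 - v.re) / Complex.normSq (1 - v)) - 1 := by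
    simp [Complex.inv_re]
  rw [e, ← Complex.normSq_eq_norm_sq, ← Complex.normSq_eq_norm_sq]
  rw [div_eq_iff h0, sub_mul, mul_assoc, div_mul_cancel₀ _ h0]
  simp [Complex.normSq_apply]
  ring

/-- Taking real parts of the Cauchy kernel sum, the left side is exactly `M` times the Poisson
kernel at `u^M`, which is largest when `u^M` is positive real. -/
lemma sum_poisson_unityRoots_le {M : ℕ} (hM : M ≠ 0) {u : ℂ} (hu : ‖u‖ < 1) :
    ∑ z ∈ unityRoots M, (1 - ‖u‖ ^ 2) / ‖1 - u * z‖ ^ 2 ≤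
      M * ((1 + ‖u‖ ^ M) / (1 - ‖u‖ ^ M)) := by
  have hU : ‖u ^ M‖ < 1 := by rw [norm_pow]; exact pow_lt_one₀ (norm_nonneg _) hu hM
  have h : ∀ z ∈ unityRoots M, (1 - ‖u‖ ^ 2) / ‖1 - u * z‖ ^ 2 =
      (2 * (1 / (1 - u * z)) - 1).re := by
    intro z hz
    have hn : ‖u * z‖ = ‖u‖ := by rw [norm_mul, norm_of_mem_unityRoots hM hz, mul_one]
    rw [← poisson_eq_re (by rwa [hn]), hn]
  rw [Finset.sum_congr rfl h, ← Complex.re_sum, Finset.sum_sub_distrib, ← Finset.mul_sum,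
    sum_inv_one_sub_unityRoots hM hu, Finset.sum_const, card_unityRoots hM]
  have e : (2 * ((M : ℂ) / (1 - u ^ M)) - M • (1 : ℂ)) =
      (M : ℝ) * (2 * (1 / (1 - u ^ M)) - 1) := by
    simp only [nsmul_eq_mul, Complex.ofReal_natCast]; ring
  rw [e, Complex.re_ofReal_mul, ← poisson_eq_re hU]
  refine mul_le_mul_of_nonneg_left ?_ (Nat.cast_nonneg _)
  rw [norm_pow] at hU ⊢
  have h1 : 1 - ‖u‖ ^ M ≤ ‖1 - u ^ M‖ := by
    have := norm_sub_norm_le (1 : ℂ) (u ^ M)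
    simpa using this
  have h2 : 0 < 1 - ‖u‖ ^ M := by linarith
  have h3 : 0 ≤ ‖u‖ ^ M := by positivity
  calc (1 - (‖u‖ ^ M) ^ 2) / ‖1 - u ^ M‖ ^ 2 ≤ (1 - (‖u‖ ^ M) ^ 2) / (1 - ‖u‖ ^ M) ^ 2 := by
        refine div_le_div_of_nonneg_left (by nlinarith) (by positivity) ?_
        exact pow_le_pow_left₀ h2.le h1 2
    _ = (1 + ‖u‖ ^ M) / (1 - ‖u‖ ^ M) := by field_simp; ring

/-- Because `∑ v^k = 0`, one has `M = ∑ (1 - v^k)`, and each term is at most `k ‖1 - v‖` in norm. As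
`∑ k = M(M-1)/2`, this even gives `2 ≤ (M-1) ‖1 - v‖`. -/
lemma two_div_le_norm_one_sub {M : ℕ} {v : ℂ} (hv : v ^ M = 1) (hv1 : v ≠ 1)
    (hM : M ≠ 0) : 2 / (M : ℝ) ≤ ‖1 - v‖ := by
  have hn : ‖v‖ = 1 := Complex.norm_eq_one_of_pow_eq_one hv hM
  have hsum : ∑ k ∈ Finset.range M, v ^ k = 0 := by
    have h := mul_neg_geom_sum v M
    rw [hv, sub_self] at h
    exact (mul_eq_zero.mp h).resolve_left (sub_ne_zero.mpr hv1.symm)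
  have hk : ∀ k : ℕ, ‖1 - v ^ k‖ ≤ k * ‖1 - v‖ := by
    intro k
    rw [← mul_neg_geom_sum v k, norm_mul, mul_comm]
    refine mul_le_mul_of_nonneg_right ?_ (norm_nonneg _)
    refine (norm_sum_le _ _).trans ?_
    simp [hn]
  have h1 : (M : ℝ) ≤ (∑ k ∈ Finset.range M, (k : ℝ)) * ‖1 - v‖ := by
    rw [Finset.sum_mul]
    calc (M : ℝ) = ‖∑ k ∈ Finset.range M, (1 - v ^ k)‖ := by
          rw [Finset.sum_sub_distrib, hsum]; simp
      _ ≤ ∑ k ∈ Finset.range M, ‖1 - v ^ k‖ := norm_sum_le _ _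
      _ ≤ _ := Finset.sum_le_sum fun k _ => hk k
  have h2 : (∑ k ∈ Finset.range M, (k : ℝ)) * 2 = M * (M - 1) := by
    have := Finset.sum_range_id_mul_two M
    have h3 : ((M - 1 : ℕ) : ℝ) = M - 1 := by
      rw [Nat.cast_sub (Nat.pos_of_ne_zero hM)]; simp
    rw [← h3, ← Nat.cast_sum]
    exact_mod_cast this
  have hMpos : (0 : ℝ) < M := by exact_mod_cast Nat.pos_of_ne_zero hM
  rw [div_le_iff₀ hMpos]
  have h4 : (M : ℝ) * 2 ≤ M * ((M - 1) * ‖1 - v‖) := by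
    calc (M : ℝ) * 2 ≤ (∑ k ∈ Finset.range M, (k : ℝ)) * ‖1 - v‖ * 2 := by linarith
      _ = ((∑ k ∈ Finset.range M, (k : ℝ)) * 2) * ‖1 - v‖ := by ring
      _ = _ := by rw [h2]; ring
  have h5 := le_of_mul_le_mul_left h4 hMpos
  nlinarith [norm_nonneg (1 - v)]

/-! ### Estimates for the kernel of the disc -/

lemma kernelSq_comm (a b : ℂ) : kernelSq a b = kernelSq b a := by
  have : ‖1 - conj a * b‖ = ‖1 - conj b * a‖ := by
    rw [← RCLike.norm_conj (1 - conj a * b)]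
    simp [mul_comm]
  rw [kernelSq, kernelSq, this, mul_comm (1 - ‖a‖ ^ 2)]

lemma one_sub_mul_norm_le (a b : ℂ) : 1 - ‖a‖ * ‖b‖ ≤ ‖1 - conj a * b‖ := by
  have := norm_sub_norm_le (1 : ℂ) (conj a * b)
  simpa using this

lemma kernelSq_nonneg {a b : ℂ} (ha : ‖a‖ < 1) (hb : ‖b‖ < 1) : 0 ≤ kernelSq a b := by
  have h1 : 0 ≤ 1 - ‖a‖ ^ 2 := by nlinarith [norm_nonneg a]
  have h2 : 0 ≤ 1 - ‖b‖ ^ 2 := by nlinarith [norm_nonneg b]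
  exact div_nonneg (mul_nonneg h1 h2) (by positivity)

/-- For given radii the kernel is largest when the arguments agree, so a bound in terms of the radii
suffices. -/
lemma kernelSq_le_of_mul_le {a b : ℂ} (ha : ‖a‖ < 1) (hb : ‖b‖ < 1) {c : ℝ} (hc : 0 ≤ c)
    (h : (1 - ‖a‖ ^ 2) * (1 - ‖b‖ ^ 2) ≤ c * (1 - ‖a‖ * ‖b‖) ^ 2) : kernelSq a b ≤ c := by
  have hab : 0 < 1 - ‖a‖ * ‖b‖ := by nlinarith [norm_nonneg a, norm_nonneg b]
  have h1 := one_sub_mul_norm_le a b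
  rw [kernelSq, div_le_iff₀ (by have := hab.trans_le h1; positivity)]
  exact h.trans (mul_le_mul_of_nonneg_left (pow_le_pow_left₀ hab.le h1 2) hc)

lemma kernelSq_le_one {a b : ℂ} (ha : ‖a‖ < 1) (hb : ‖b‖ < 1) : kernelSq a b ≤ 1 :=
  kernelSq_le_of_mul_le ha hb zero_le_one (by nlinarith [sq_nonneg (‖a‖ - ‖b‖)])

/-- With `s, t` the two heights, `1 - ‖a‖‖b‖ ≥ (s+t)/2` bounds the kernel by `4st/(s+t)²`, which
equals `8/9` at `t = 2s` and decreases for larger `t/s`. -/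
lemma kernelSq_le_of_two_mul_le {a b : ℂ} (ha : ‖a‖ < 1) (hb : ‖b‖ < 1)
    (h : 2 * (1 - ‖a‖ ^ 2) ≤ 1 - ‖b‖ ^ 2) : kernelSq a b ≤ 8 / 9 := by
  refine kernelSq_le_of_mul_le ha hb (by norm_num) ?_
  have h1 : 0 ≤ 1 - ‖a‖ ^ 2 := by nlinarith [norm_nonneg a]
  have h3 : ((1 - ‖a‖ ^ 2) + (1 - ‖b‖ ^ 2)) / 2 ≤ 1 - ‖a‖ * ‖b‖ := by
    nlinarith [sq_nonneg (‖a‖ - ‖b‖)]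
  set s := 1 - ‖a‖ ^ 2
  set t := 1 - ‖b‖ ^ 2
  have h4 : ((s + t) / 2) ^ 2 ≤ (1 - ‖a‖ * ‖b‖) ^ 2 :=
    pow_le_pow_left₀ (by linarith) h3 2
  -- The identity behind this is `2(s+t)² - 9st = (t - 2s)(2t - s)`.
  nlinarith [mul_nonneg (by linarith : 0 ≤ t - 2 * s) (by linarith : 0 ≤ 2 * t - s)]

/-! ### Equally spaced points on a circle -/

/-- The radius `r` with `1 - r² = 2⁻ᵃ`. -/
noncomputable def ringRadius (a : ℕ) : ℝ := √(1 - (1 / 2) ^ a)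

lemma ringRadius_nonneg (a : ℕ) : 0 ≤ ringRadius a := Real.sqrt_nonneg _

lemma ringRadius_sq (a : ℕ) : ringRadius a ^ 2 = 1 - (1 / 2) ^ a :=
  Real.sq_sqrt (sub_nonneg.mpr (pow_le_one₀ (by norm_num) (by norm_num)))

lemma ringRadius_pos {a : ℕ} (ha : a ≠ 0) : 0 < ringRadius a :=
  Real.sqrt_pos.mpr (sub_pos.mpr (pow_lt_one₀ (by norm_num) (by norm_num) ha))

lemma ringRadius_lt_one (a : ℕ) : ringRadius a < 1 := by
  have h := ringRadius_sq a
  have : (0 : ℝ) < (1 / 2) ^ a := by positivity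
  nlinarith [ringRadius_nonneg a]

/-- The `2ᵃ` equally spaced points on the circle of radius `r`, where `1 - r² = 2⁻ᵃ`. -/
noncomputable def ringPoints (a : ℕ) : Finset ℂ :=
  (unityRoots (2 ^ a)).image fun z => (ringRadius a : ℂ) * z

lemma two_pow_ne_zero (a : ℕ) : 2 ^ a ≠ 0 := by positivity

lemma norm_of_mem_ringPoints {a : ℕ} {x : ℂ} (hx : x ∈ ringPoints a) : ‖x‖ = ringRadius a := by
  obtain ⟨z, hz, rfl⟩ := Finset.mem_image.mp hx
  rw [norm_mul, norm_of_mem_unityRoots (two_pow_ne_zero a) hz, Complex.norm_real, mul_one,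
    Real.norm_of_nonneg (ringRadius_nonneg a)]

lemma norm_lt_one_of_mem_ringPoints {a : ℕ} {x : ℂ} (hx : x ∈ ringPoints a) : ‖x‖ < 1 := by
  rw [norm_of_mem_ringPoints hx]; exact ringRadius_lt_one a

lemma one_sub_norm_sq_of_mem_ringPoints {a : ℕ} {x : ℂ} (hx : x ∈ ringPoints a) :
    1 - ‖x‖ ^ 2 = (1 / 2) ^ a := by
  rw [norm_of_mem_ringPoints hx, ringRadius_sq]; ring

lemma ringRadius_mul_injective {a : ℕ} (ha : a ≠ 0) :
    Function.Injective fun z : ℂ => (ringRadius a : ℂ) * z :=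
  mul_right_injective₀ (Complex.ofReal_ne_zero.mpr (ringRadius_pos ha).ne')

lemma card_ringPoints {a : ℕ} (ha : a ≠ 0) : (ringPoints a).card = 2 ^ a := by
  rw [ringPoints, Finset.card_image_of_injective _ (ringRadius_mul_injective ha),
    card_unityRoots (two_pow_ne_zero a)]

lemma conj_mem_ringPoints {a : ℕ} {x : ℂ} (hx : x ∈ ringPoints a) : conj x ∈ ringPoints a := by
  obtain ⟨z, hz, rfl⟩ := Finset.mem_image.mp hx
  refine Finset.mem_image.mpr ⟨conj z, ?_, by simp⟩
  rw [mem_unityRoots (two_pow_ne_zero a)] at hz ⊢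
  rw [← map_pow, hz, map_one]

/-- With `M = 2ᵃ` and `t = 1/M`, Bernoulli gives `(1+t)^M ≥ 2`, hence `(1-t)^M ≤ 1/2` and `r^M ≤
1/√2`. This gap below 1 keeps the Poisson sum over a ring comparable to the number of its points. -/
lemma ringRadius_pow_le (a : ℕ) : ringRadius a ^ 2 ^ a ≤ 3 / 4 := by
  set t : ℝ := (1 / 2) ^ a with ht
  have ht0 : 0 < t := by positivity
  have ht1 : t ≤ 1 := pow_le_one₀ (by norm_num) (by norm_num)
  have hMt : ((2 ^ a : ℕ) : ℝ) * t = 1 := by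
    rw [ht]; push_cast; rw [← mul_pow]; norm_num
  have h1 : 2 ≤ (1 + t) ^ 2 ^ a := by
    have := one_add_mul_le_pow (by linarith : (-2 : ℝ) ≤ t) (2 ^ a)
    linarith
  have h2 : (1 - t) ^ 2 ^ a * (1 + t) ^ 2 ^ a ≤ 1 := by
    rw [← mul_pow]
    exact pow_le_one₀ (by nlinarith) (by nlinarith)
  have h3 : 0 ≤ (1 - t) ^ 2 ^ a := pow_nonneg (by linarith) _
  have h4 : (ringRadius a ^ 2 ^ a) ^ 2 = (1 - t) ^ 2 ^ a := by
    rw [← pow_mul, mul_comm, pow_mul, ringRadius_sq]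
  nlinarith [pow_nonneg (ringRadius_nonneg a) (2 ^ a)]

/-- Up to the factor `st/(s+t-st)`, the terms are Poisson kernels at `u z` with `u = conj b * r`, so
the sum is at most `7s/(s+t-st)`. The denominator dominates both `s` and `t`. The truncated exponent
`c - a` records both cases: no decay if `c ≤ a`, the ratio `s/t` otherwise. -/
lemma sum_kernelSq_ringPoints_le {a c : ℕ} (ha : a ≠ 0) {b : ℂ} (hb : 1 - ‖b‖ ^ 2 = (1 / 2) ^ c) :
    ∑ x ∈ ringPoints a, kernelSq x b ≤ 7 * (1 / 2) ^ (c - a) := by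
  set r := ringRadius a with hr
  set t : ℝ := (1 / 2) ^ a with ht
  set s : ℝ := (1 / 2) ^ c with hs
  have ht0 : 0 < t := by positivity
  have hs0 : 0 < s := by positivity
  have hs1 : s ≤ 1 := pow_le_one₀ (by norm_num) (by norm_num)
  have ht1 : t ≤ 1 := pow_le_one₀ (by norm_num) (by norm_num)
  have hr0 : 0 ≤ r := ringRadius_nonneg a
  have hr1 : r < 1 := ringRadius_lt_one a
  have hr2 : r ^ 2 = 1 - t := ringRadius_sq a
  have hb1 : ‖b‖ < 1 := by nlinarith [norm_nonneg b]
  set u : ℂ := conj b * r with hu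
  have hun : ‖u‖ = ‖b‖ * r := by
    rw [hu, norm_mul, RCLike.norm_conj, Complex.norm_real, Real.norm_of_nonneg hr0]
  have hur : ‖u‖ ≤ r := by rw [hun]; exact mul_le_of_le_one_left hr0 hb1.le
  have hu1 : ‖u‖ < 1 := hur.trans_lt hr1
  have hu2 : 1 - ‖u‖ ^ 2 = s + t - s * t := by
    rw [hun, mul_pow, hr2]
    have : ‖b‖ ^ 2 = 1 - s := by linarith
    rw [this]; ring
  have hD : 0 < s + t - s * t := by nlinarith
  have hsum := sum_poisson_unityRoots_le (two_pow_ne_zero a) hu1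
  have hU : ‖u‖ ^ 2 ^ a ≤ 3 / 4 :=
    (pow_le_pow_left₀ (norm_nonneg u) hur _).trans (ringRadius_pow_le a)
  -- The constant is `(1 + 3/4)/(1 - 3/4) = 7`.
  have hq : (1 + ‖u‖ ^ 2 ^ a) / (1 - ‖u‖ ^ 2 ^ a) ≤ 7 := by
    rw [div_le_iff₀ (by linarith)]; linarith
  have hMt : ((2 ^ a : ℕ) : ℝ) * t = 1 := by
    rw [ht]; push_cast; rw [← mul_pow]; norm_num
  have e : ∑ x ∈ ringPoints a, kernelSq x b =
      s * t / (s + t - s * t) *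
        ∑ z ∈ unityRoots (2 ^ a), (1 - ‖u‖ ^ 2) / ‖1 - u * z‖ ^ 2 := by
    rw [ringPoints, Finset.sum_image fun x _ y _ h => ringRadius_mul_injective ha h,
      Finset.mul_sum]
    refine Finset.sum_congr rfl fun z hz => ?_
    have hn : ‖(ringRadius a : ℂ) * z‖ = r :=
      norm_of_mem_ringPoints (Finset.mem_image_of_mem _ hz)
    rw [kernelSq_comm, kernelSq, hb, hn, hr2, hu2, ← mul_assoc, ← hr, ← hu]
    field_simp
    ring
  have hk : s * t / (s + t - s * t) * (((2 ^ a : ℕ) : ℝ) * 7) ≤ 7 * (1 / 2) ^ (c - a) := by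
    have e2 : s * t / (s + t - s * t) * (((2 ^ a : ℕ) : ℝ) * 7) = 7 * (s / (s + t - s * t)) := by
      rw [div_mul_eq_mul_div, mul_div_assoc', div_left_inj' hD.ne']
      linear_combination (7 * s) * hMt
    rw [e2]
    refine mul_le_mul_of_nonneg_left ?_ (by norm_num)
    rw [div_le_iff₀ hD]
    rcases le_total c a with hca | hac
    · rw [Nat.sub_eq_zero_of_le hca]
      nlinarith
    · have hst : s = (1 / 2) ^ (c - a) * t := by
        rw [hs, ht, ← pow_add, Nat.sub_add_cancel hac]
      have : (0 : ℝ) < (1 / 2) ^ (c - a) := by positivity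
      nlinarith [mul_nonneg hs0.le (sub_nonneg.mpr ht1), mul_pos this hs0]
  rw [e]
  refine le_trans (mul_le_mul_of_nonneg_left (hsum.trans ?_) (by positivity)) hk
  exact mul_le_mul_of_nonneg_left hq (Nat.cast_nonneg _)

lemma kernelSq_le_of_mem_ringPoints {a : ℕ} (ha : a ≠ 0) {x y : ℂ} (hx : x ∈ ringPoints a)
    (hy : y ∈ ringPoints a) (hxy : x ≠ y) : kernelSq x y ≤ 8 / 9 := by
  have hsx := one_sub_norm_sq_of_mem_ringPoints hx
  have hsy := one_sub_norm_sq_of_mem_ringPoints hy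
  obtain ⟨z, hz, rfl⟩ := Finset.mem_image.mp hx
  obtain ⟨w, hw, rfl⟩ := Finset.mem_image.mp hy
  have hM := two_pow_ne_zero a
  have hz1 : conj z * z = 1 := by
    rw [Complex.conj_mul', norm_of_mem_unityRoots hM hz]; simp
  set v := conj z * w with hv
  have hvM : v ^ 2 ^ a = 1 := by
    rw [hv, mul_pow, ← map_pow, (mem_unityRoots hM).mp hz, (mem_unityRoots hM).mp hw, map_one,
      one_mul]
  have hv1 : v ≠ 1 := by
    intro h
    apply hxy
    have : w = z := by
      calc w = (conj z * z) * w := by rw [hz1, one_mul]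
        _ = z * v := by rw [hv]; ring
        _ = z := by rw [h, mul_one]
    rw [this]
  have hvn : ‖v‖ = 1 := Complex.norm_eq_one_of_pow_eq_one hvM hM
  have hsep := two_div_le_norm_one_sub hvM hv1 hM
  set t : ℝ := (1 / 2) ^ a with ht
  have ht0 : 0 < t := by positivity
  have ht1 : t ≤ 1 / 2 := by
    rw [ht]; exact pow_le_of_le_one (by norm_num) (by norm_num) ha
  have hMt : 2 / ((2 ^ a : ℕ) : ℝ) = 2 * t := by
    rw [ht]; push_cast; rw [one_div, inv_pow]; ring
  rw [hMt] at hsep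
  have hr2 : ringRadius a ^ 2 = 1 - t := ringRadius_sq a
  have e : conj ((ringRadius a : ℂ) * z) * (ringRadius a * w) = ((1 - t : ℝ) : ℂ) * v := by
    rw [← hr2, hv, map_mul, Complex.conj_ofReal]; push_cast; ring
  -- With `‖1 - v‖ ≥ 2t` and `t ≤ 1/2` the right side is at least `3t²`, so the kernel is even at
  -- most `1/3`; `8/9` matches the bound between different rings.
  have hn : ‖1 - ((1 - t : ℝ) : ℂ) * v‖ ^ 2 = t ^ 2 + (1 - t) * ‖1 - v‖ ^ 2 := by
    have h1 : v.re * v.re + v.im * v.im = 1 := by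
      rw [← Complex.normSq_apply, Complex.normSq_eq_norm_sq, hvn, one_pow]
    rw [← Complex.normSq_eq_norm_sq, ← Complex.normSq_eq_norm_sq]
    simp only [Complex.normSq_apply, Complex.sub_re, Complex.sub_im, Complex.one_re,
      Complex.one_im, Complex.re_ofReal_mul, Complex.im_ofReal_mul]
    linear_combination ((1 - t) ^ 2 - (1 - t)) * h1
  have hsq : (2 * t) ^ 2 ≤ ‖1 - v‖ ^ 2 := pow_le_pow_left₀ (by positivity) hsep 2
  rw [kernelSq, hsx, hsy, e, hn, div_le_iff₀ (by
    have : 0 ≤ (1 - t) * ‖1 - v‖ ^ 2 := mul_nonneg (by linarith) (by positivity)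
    positivity)]
  nlinarith [mul_le_mul (by linarith : 1 / 2 ≤ 1 - t) hsq (by positivity) (by linarith)]

lemma kernelSq_le_of_mem_ringPoints_of_lt {a c : ℕ} (hac : a < c) {x y : ℂ}
    (hx : x ∈ ringPoints a) (hy : y ∈ ringPoints c) : kernelSq x y ≤ 8 / 9 := by
  rw [kernelSq_comm]
  refine kernelSq_le_of_two_mul_le (norm_lt_one_of_mem_ringPoints hy)
    (norm_lt_one_of_mem_ringPoints hx) ?_
  rw [one_sub_norm_sq_of_mem_ringPoints hx, one_sub_norm_sq_of_mem_ringPoints hy]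
  calc 2 * (1 / 2 : ℝ) ^ c ≤ 2 * (1 / 2) ^ (a + 1) :=
        mul_le_mul_of_nonneg_left
          (pow_le_pow_of_le_one (by norm_num) (by norm_num) hac) (by norm_num)
    _ = (1 / 2) ^ a := by rw [pow_succ]; ring

/-! ### The set of points -/

/-- One of the truncated exponents is always zero, so the terms are `2^(-|m-i|)`; each side of `m`
is a geometric series of sum at most 2. -/
lemma sum_half_pow_dist_le (n m : ℕ) :
    ∑ i ∈ Finset.range n, ((1 / 2 : ℝ) ^ (m - i) * (1 / 2) ^ (i - m)) ≤ 4 := by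
  calc ∑ i ∈ Finset.range n, ((1 / 2 : ℝ) ^ (m - i) * (1 / 2) ^ (i - m))
      ≤ ∑ i ∈ Finset.range (m + 1 + n), ((1 / 2 : ℝ) ^ (m - i) * (1 / 2) ^ (i - m)) :=
        Finset.sum_le_sum_of_subset_of_nonneg
          (Finset.range_subset_range.mpr (by omega)) fun _ _ _ => by positivity
    _ ≤ ∑ i ∈ Finset.range (m + 1), (1 / 2 : ℝ) ^ i + ∑ i ∈ Finset.range n, (1 / 2 : ℝ) ^ i := by
        rw [Finset.sum_range_add,
          ← Finset.sum_range_reflect (fun i => (1 / 2 : ℝ) ^ i) (m + 1)]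
        refine add_le_add (Finset.sum_le_sum fun i hi => ?_) (Finset.sum_le_sum fun i _ => ?_)
        · have : i ≤ m := Nat.lt_succ_iff.mp (Finset.mem_range.mp hi)
          rw [Nat.sub_eq_zero_of_le this, pow_zero, mul_one, Nat.add_sub_cancel]
        · rw [← pow_add]
          exact pow_le_pow_of_le_one (by norm_num) (by norm_num) (by omega)
    _ ≤ 4 := by linarith [sum_geometric_two_le (m + 1), sum_geometric_two_le n]

/-- The union of the products of two rings of points with the dimensions `2⁻ᵃ × 2⁻ᵇ`,
over all `a, b ≥ 1` with `a + b = n + 1`. -/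
noncomputable def productRings (n : ℕ) : Finset (ℂ × ℂ) :=
  (Finset.range n).biUnion fun i => ringPoints (i + 1) ×ˢ ringPoints (n - i)

lemma mem_productRings {n : ℕ} {x : ℂ × ℂ} :
    x ∈ productRings n ↔ ∃ i < n, x.1 ∈ ringPoints (i + 1) ∧ x.2 ∈ ringPoints (n - i) := by
  simp [productRings]

lemma productRings_subset_bidisc (n : ℕ) : (productRings n : Set (ℂ × ℂ)) ⊆ bidisc := by
  intro x hx
  obtain ⟨i, -, h1, h2⟩ := mem_productRings.mp (Finset.mem_coe.mp hx)
  exact ⟨mem_ball_zero_iff.mpr (norm_lt_one_of_mem_ringPoints h1),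
    mem_ball_zero_iff.mpr (norm_lt_one_of_mem_ringPoints h2)⟩

lemma mul_one_sub_norm_sq_of_mem_productRings {n : ℕ} {x : ℂ × ℂ} (hx : x ∈ productRings n) :
    (1 - ‖x.1‖ ^ 2) * (1 - ‖x.2‖ ^ 2) = (1 / 2) ^ (n + 1) := by
  obtain ⟨i, hi, h1, h2⟩ := mem_productRings.mp hx
  rw [one_sub_norm_sq_of_mem_ringPoints h1, one_sub_norm_sq_of_mem_ringPoints h2, ← pow_add]
  congr 1
  omega

lemma sigma_image_productRings (n : ℕ) :
    sigma '' (productRings n : Set (ℂ × ℂ)) = (productRings n : Set (ℂ × ℂ)) := by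
  have h : ∀ x ∈ productRings n, sigma x ∈ productRings n := by
    intro x hx
    obtain ⟨i, hi, h1, h2⟩ := mem_productRings.mp hx
    exact mem_productRings.mpr ⟨i, hi, conj_mem_ringPoints h1, h2⟩
  refine Set.Subset.antisymm (Set.image_subset_iff.mpr fun x hx => h x hx) fun x hx => ?_
  exact ⟨sigma x, h x hx, by simp [sigma]⟩

lemma disjoint_ringPoints {a c : ℕ} (hac : a ≠ c) : Disjoint (ringPoints a) (ringPoints c) := by
  refine Finset.disjoint_left.mpr fun x hx hy => hac ?_
  have h := (one_sub_norm_sq_of_mem_ringPoints hx).symm.trans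
    (one_sub_norm_sq_of_mem_ringPoints hy)
  exact pow_right_injective₀ (by norm_num) (by norm_num) h

lemma pairwiseDisjoint_productRings (n : ℕ) :
    (Finset.range n : Set ℕ).PairwiseDisjoint
      fun i => ringPoints (i + 1) ×ˢ ringPoints (n - i) := by
  intro i _ j _ hij
  exact Finset.disjoint_product.mpr (Or.inl (disjoint_ringPoints (by omega)))

lemma card_productRings (n : ℕ) : (productRings n).card = n * 2 ^ (n + 1) := by
  rw [productRings, Finset.card_biUnion (pairwiseDisjoint_productRings n)]
  calc ∑ i ∈ Finset.range n, (ringPoints (i + 1) ×ˢ ringPoints (n - i)).card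
      = ∑ i ∈ Finset.range n, 2 ^ (n + 1) := by
        refine Finset.sum_congr rfl fun i hi => ?_
        have := Finset.mem_range.mp hi
        rw [Finset.card_product, card_ringPoints (by omega), card_ringPoints (by omega), ← pow_add]
        congr 1
        omega
    _ = n * 2 ^ (n + 1) := by simp

lemma weaklySeparated_productRings (n : ℕ) : WeaklySeparated (1 / 3) (productRings n) := by
  have hs : sSup {x : ℝ | ∃ a ∈ productRings n, ∃ b ∈ productRings n, a ≠ b ∧
      x = ‖hardyInner (normSzego a) (normSzego b)‖ ^ 2} ≤ 8 / 9 := by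
    -- Nonnegativity of the bound covers the empty set, whose `sSup` is 0.
    refine Real.sSup_le ?_ (by norm_num)
    rintro _ ⟨a, ha, b, hb, hab, rfl⟩
    rw [norm_hardyInner_normSzego_sq (productRings_subset_bidisc n ha)
      (productRings_subset_bidisc n hb)]
    obtain ⟨i, hi, a1, a2⟩ := mem_productRings.mp ha
    obtain ⟨j, hj, b1, b2⟩ := mem_productRings.mp hb
    have na1 := norm_lt_one_of_mem_ringPoints a1
    have na2 := norm_lt_one_of_mem_ringPoints a2
    have nb1 := norm_lt_one_of_mem_ringPoints b1
    have nb2 := norm_lt_one_of_mem_ringPoints b2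
    have k1 := kernelSq_le_one na1 nb1
    have k2 := kernelSq_le_one na2 nb2
    have p1 := kernelSq_nonneg na1 nb1
    have p2 := kernelSq_nonneg na2 nb2
    -- One small factor suffices, the other being at most 1. Different grids are told apart by the
    -- first radius; in one grid, some coordinate has a different angle.
    have key : kernelSq a.1 b.1 ≤ 8 / 9 ∨ kernelSq a.2 b.2 ≤ 8 / 9 := by
      rcases lt_trichotomy i j with hij | rfl | hij
      · exact Or.inl (kernelSq_le_of_mem_ringPoints_of_lt (by omega) a1 b1)
      · by_cases h1 : a.1 = b.1
        · exact Or.inr (kernelSq_le_of_mem_ringPoints (by omega) a2 b2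
            fun h2 => hab (Prod.ext h1 h2))
        · exact Or.inl (kernelSq_le_of_mem_ringPoints (by omega) a1 b1 h1)
      · exact Or.inl ((kernelSq_comm _ _).trans_le
          (kernelSq_le_of_mem_ringPoints_of_lt (by omega) b1 a1))
    rcases key with h | h
    · exact (mul_le_of_le_one_right p1 k2).trans h
    · exact (mul_le_of_le_one_left p2 k1).trans h
  rw [WeaklySeparated, weakSepConst]
  exact Real.le_sqrt_of_sq_le (by linarith only [hs])

lemma columnBounded_productRings (n : ℕ) : ColumnBounded 196 (productRings n) := by
  refine Real.sSup_le ?_ (by norm_num)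
  rintro _ ⟨b, hb, rfl⟩
  obtain ⟨j, hj, b1, b2⟩ := mem_productRings.mp hb
  have hb' := productRings_subset_bidisc n hb
  -- Restoring the diagonal term lets the sum over each grid factor into two ring sums.
  calc ∑ a ∈ (productRings n).erase b, ‖hardyInner (normSzego a) (normSzego b)‖ ^ 2
      ≤ ∑ a ∈ productRings n, ‖hardyInner (normSzego a) (normSzego b)‖ ^ 2 :=
        Finset.sum_le_sum_of_subset_of_nonneg (Finset.erase_subset _ _)
          fun _ _ _ => by positivity
    _ = ∑ a ∈ productRings n, kernelSq a.1 b.1 * kernelSq a.2 b.2 :=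
        Finset.sum_congr rfl fun a ha =>
          norm_hardyInner_normSzego_sq (productRings_subset_bidisc n ha) hb'
    _ = ∑ i ∈ Finset.range n, (∑ x ∈ ringPoints (i + 1), kernelSq x b.1) *
          ∑ y ∈ ringPoints (n - i), kernelSq y b.2 := by
        rw [productRings, Finset.sum_biUnion (pairwiseDisjoint_productRings n)]
        refine Finset.sum_congr rfl fun i _ => ?_
        rw [Finset.sum_product, Finset.sum_mul_sum]
    _ ≤ ∑ i ∈ Finset.range n, 49 * ((1 / 2 : ℝ) ^ (j - i) * (1 / 2) ^ (i - j)) := by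
        refine Finset.sum_le_sum fun i hi => ?_
        have hin := Finset.mem_range.mp hi
        have s1 := sum_kernelSq_ringPoints_le (a := i + 1) (by omega)
          (one_sub_norm_sq_of_mem_ringPoints b1)
        have s2 := sum_kernelSq_ringPoints_le (a := n - i) (by omega)
          (one_sub_norm_sq_of_mem_ringPoints b2)
        -- The second exponents run in the opposite direction, so the two truncated differences are
        -- `j - i` and `i - j`, and their decays combine to `2^(-|i-j|)`.
        rw [show j + 1 - (i + 1) = j - i by omega] at s1
        rw [show n - j - (n - i) = i - j by omega] at s2
        have p2 : 0 ≤ ∑ y ∈ ringPoints (n - i), kernelSq y b.2 :=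
          Finset.sum_nonneg fun y hy => kernelSq_nonneg (norm_lt_one_of_mem_ringPoints hy)
            (norm_lt_one_of_mem_ringPoints b2)
        refine (mul_le_mul s1 s2 p2 (by positivity)).trans (le_of_eq ?_)
        ring
    _ ≤ 196 := by
        rw [← Finset.mul_sum]
        linarith [sum_half_pow_dist_le n j]

/-! ### The Carleson condition -/

lemma mem_region_univ {z : ℂ} (h0 : z ≠ 0) (h1 : ‖z‖ < 1) : z ∈ region Set.univ := by
  refine ⟨mem_ball_zero_iff.mpr h1, h0, ?_, ?_⟩
  · rw [UnitAddCircle.measure_univ]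
    simp
  · have hn : ‖z‖ ≠ 0 := norm_ne_zero_iff.mpr h0
    have hz : ‖z / (‖z‖ : ℂ)‖ = 1 := by
      rw [norm_div, Complex.norm_real, norm_norm, div_self hn]
    obtain ⟨θ, hθ⟩ := (AddCircle.homeomorphCircle (one_ne_zero (α := ℝ))).surjective
      (⟨z / (‖z‖ : ℂ), mem_sphere_zero_iff_norm.mpr hz⟩ : Circle)
    refine ⟨θ, Set.mem_univ _, ?_⟩
    rw [AddCircle.homeomorphCircle_apply] at hθ
    rw [hθ]

/-- Carleson regions omit the origin; the points avoid it because all ring indices are at least 1.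
-/
lemma productRings_subset_tent_univ (n : ℕ) :
    (productRings n : Set (ℂ × ℂ)) ⊆ tent Set.univ := by
  intro x hx
  obtain ⟨i, hi, h1, h2⟩ := mem_productRings.mp (Finset.mem_coe.mp hx)
  have ne : ∀ {a : ℕ} {z : ℂ}, a ≠ 0 → z ∈ ringPoints a → z ≠ 0 := by
    intro a z ha hz h
    have := norm_of_mem_ringPoints hz
    rw [h, norm_zero] at this
    exact (ringRadius_pos ha).ne this
  exact ⟨Set.univ, Set.univ, isConnected_univ, isConnected_univ, Set.subset_univ _,
    mem_region_univ (ne (by omega) h1) (norm_lt_one_of_mem_ringPoints h1),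
    mem_region_univ (ne (by omega) h2) (norm_lt_one_of_mem_ringPoints h2)⟩

lemma pointMeasure_productRings_tent_univ (n : ℕ) :
    pointMeasure (productRings n) (tent Set.univ) = n := by
  have h : ∀ a ∈ productRings n,
      (ENNReal.ofReal ((1 - ‖a.1‖ ^ 2) * (1 - ‖a.2‖ ^ 2)) • Measure.dirac a) (tent Set.univ) =
        ENNReal.ofReal ((1 / 2) ^ (n + 1)) := by
    intro a ha
    rw [mul_one_sub_norm_sq_of_mem_productRings ha, Measure.smul_apply,
      Measure.dirac_apply_of_mem (productRings_subset_tent_univ n ha), smul_eq_mul, mul_one]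
  rw [pointMeasure, Measure.finsetSum_apply, Finset.sum_congr rfl h, Finset.sum_const,
    card_productRings, nsmul_eq_mul, ← ENNReal.ofReal_natCast, ← ENNReal.ofReal_mul (by positivity),
    ← ENNReal.ofReal_natCast]
  congr 1
  push_cast
  rw [mul_assoc, ← mul_pow]
  norm_num

end Bidisc

theorem corollary5p2 :
    ∃ γ Δ : ℝ, 0 < γ ∧ γ < 1 ∧ 0 < Δ ∧
      ∀ ε : ℝ, 0 < ε →
        ∃ Λ : Finset (ℂ × ℂ),
          (Λ : Set (ℂ × ℂ)) ⊆ Bidisc.bidisc ∧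
          Bidisc.sigma '' (Λ : Set (ℂ × ℂ)) = (Λ : Set (ℂ × ℂ)) ∧
          Bidisc.WeaklySeparated γ Λ ∧
          Bidisc.ColumnBounded Δ Λ ∧
          ENNReal.ofReal ε⁻¹ ≤
            (⨆ (V : Set Bidisc.Torus) (_ : IsOpen V) (_ : V.Nonempty),
              Bidisc.pointMeasure Λ (Bidisc.tent V) / MeasureTheory.volume V) ∧
          (∃ c : ℝ, ∀ a ∈ Λ, Bidisc.hardyNorm (Bidisc.szego a) = c) := by
  refine ⟨1 / 3, 196, by norm_num, by norm_num, by norm_num, fun ε _ => ?_⟩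
  -- The mass over the whole torus equals the number `n` of grids, so `n ≥ ε⁻¹` grids are enough.
  obtain ⟨n, hn⟩ := exists_nat_ge ε⁻¹
  refine ⟨Bidisc.productRings n, Bidisc.productRings_subset_bidisc n,
    Bidisc.sigma_image_productRings n, Bidisc.weaklySeparated_productRings n,
    Bidisc.columnBounded_productRings n, ?_, √(1 / (1 / 2) ^ (n + 1)), fun a ha => ?_⟩
  · refine le_iSup_of_le Set.univ (le_iSup_of_le isOpen_univ (le_iSup_of_le Set.univ_nonempty ?_))
    rw [Bidisc.pointMeasure_productRings_tent_univ, MeasureTheory.measure_univ, div_one]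
    exact (ENNReal.ofReal_le_ofReal hn).trans_eq (ENNReal.ofReal_natCast n)
  · rw [Bidisc.hardyNorm_szego (Bidisc.productRings_subset_bidisc n ha),
      Bidisc.mul_one_sub_norm_sq_of_mem_productRings ha]
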